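/- Let $B_1$ be the open unit disk of $\mathbb R^2$, let $a,b,m>0$ and $q>2$. For an open set $\Omega\subset\mathbb R^2$ and a function $u$ that is $C^1$ in $\Omega\setminus\{0\}$, we say that $$-\Delta u+ae^{bu}-m|\nabla u|^q=0\quad\text{in }\mathcal D'(\Omega)\qquad (E)$$ if $u$, $e^{bu}$ and $|\nabla u|^q$ belong to $L^1_{loc}(\Omega)$ and $\int_\Omega\big(-u\,\Delta\zeta+(ae^{bu}-m|\nabla u|^q)\zeta\big)\,dx=0$ for all $\zeta\in C_c^\infty(\Omega)$. Let $u\in C^1(\overline B_1\setminus\{0\})$ be positive in $B_1\setminus\{0\}$ and satisfy (E) in $\mathcal D'(B_1\setminus\{0\})$. Then the following statements are equivalent: (i) $e^{bu}\in L^1(B_1)$; (ii) $|\nabla u|^q\in L^1(B_1)$; (iii) $u$ can be extended to $\overline B_1$ as a Hölder continuous function (with some exponent $\alpha\in(0,1]$), and the extended function satisfies (E) in $\mathcal D'(B_1)$; in particular there is no Dirac mass at $0$. -/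

import Mathlib

open MeasureTheory Metric Set
open scoped ContDiff

/-- The Euclidean plane. -/
abbrev Plane : Type := EuclideanSpace ℝ (Fin 2)

/-- `u` solves `-Δu + a e^{bu} - m |∇u|^q = 0` in the sense of distributions in the open set `Ω`:
`u`, `e^{bu}` and `|∇u|^q` are in `L¹_loc(Ω)` and
`∫_Ω (-u Δζ + (a e^{bu} - m |∇u|^q) ζ) = 0` for every test function `ζ ∈ C_c^∞(Ω)`.
The gradient is the pointwise one: the notion is meant for functions that are `C¹` in `Ω` except
possibly at the origin. -/
def IsDistributionalSolution (a b m q : ℝ) (u : Plane → ℝ) (Ω : Set Plane) : Prop :=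
  LocallyIntegrableOn u Ω volume ∧
  LocallyIntegrableOn (fun x => Real.exp (b * u x)) Ω volume ∧
  LocallyIntegrableOn (fun x => ‖gradient u x‖ ^ q) Ω volume ∧
  ∀ ζ : Plane → ℝ, ContDiff ℝ ∞ ζ → HasCompactSupport ζ → tsupport ζ ⊆ Ω →
    ∫ x in Ω, (-(u x * Laplacian.laplacian ζ x)
      + (a * Real.exp (b * u x) - m * ‖gradient u x‖ ^ q) * ζ x) = 0

/-- `u` is Hölder continuous on `s`, with some exponent `α ∈ (0, 1]`. -/
def IsHolderContinuousOn (u : Plane → ℝ) (s : Set Plane) : Prop :=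
  ∃ C α : NNReal, 0 < α ∧ α ≤ 1 ∧ HolderOnWith C α u s

/-! The three conditions are linked in a cycle, and both hard arrows rest on `2 < q` in dimension
two.

From the exponential to the gradient: testing the equation with `ξ²`, where `ξ` is supported in the
punctured disk, turns `m ∫ |∇u|^q ξ²` into `a ∫ e^{bu} ξ² + 2 ∫ ξ ∇u·∇ξ`. As `q > 2`, Young's
inequality absorbs half of the left side and leaves only the Dirichlet energy of `ξ`
(`setIntegral_gradient_rpow_mul_sq_le`). In the plane that energy is scale invariant, so cutoffs
exhausting the punctured disk have bounded energy (`exists_punctured_cutoff`), and Fatou concludes.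

From the gradient to the extension: since `q` exceeds the dimension, Morrey's estimate makes `u`
Hölder with exponent `1 - 2/q` (`exists_holderOnWith_of_integrableOn_gradient_rpow`). Almost every
segment from a given point misses the origin, so the puncture is harmless. The continuous extension
`v` solves the equation across `0`: a test function cut off at scale `1/R` has Laplacian `O(R²)` on
a set of area `O(R⁻²)`, paired with `v - v(0) = O(R^{-α})` (`integral_weak_eq_zero_of_punctured`).

From the extension to the exponential: a continuous function on a compact disk is bounded. -/

/-! ### Laplacians, gradients and Green's formula -/

lemma integrable_mul_of_continuousOn {U : Set Plane} {f g : Plane → ℝ}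
    (hf : ContinuousOn f U) (hg : Continuous g) (hK : HasCompactSupport g) (hKU : tsupport g ⊆ U) :
    Integrable (fun x => f x * g x) := by
  have h1 : IntegrableOn (fun x => f x * g x) (tsupport g) :=
    ((hf.mono hKU).mul hg.continuousOn).integrableOn_compact hK
  refine (integrableOn_iff_integrable_of_support_subset ?_).1 h1
  intro x hx
  refine subset_tsupport g ?_
  rw [Function.mem_support] at hx ⊢
  exact right_ne_zero_of_mul hx

lemma laplacian_eq_sum_fderiv_fderiv {ζ : Plane → ℝ} (hζ : ContDiff ℝ 2 ζ) (x : Plane) :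
    Laplacian.laplacian ζ x = ∑ i, fderiv ℝ (fun y => fderiv ℝ ζ y (EuclideanSpace.basisFun (Fin 2) ℝ i)) x
      (EuclideanSpace.basisFun (Fin 2) ℝ i) := by
  rw [InnerProductSpace.laplacian_eq_iteratedFDeriv_orthonormalBasis ζ
    (EuclideanSpace.basisFun (Fin 2) ℝ)]
  refine Finset.sum_congr rfl fun i _ => ?_
  have hd : DifferentiableAt ℝ (fderiv ℝ ζ) x :=
    ((hζ.fderiv_right (m := 1) (by norm_num)).differentiable (by norm_num)).differentiableAt
  rw [iteratedFDeriv_two_apply, fderiv_clm_apply hd (differentiableAt_const _)]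
  simp

lemma inner_gradient_eq_sum_fderiv (u ζ : Plane → ℝ) (x : Plane) :
    inner ℝ (gradient u x) (gradient ζ x) = ∑ i, fderiv ℝ u x (EuclideanSpace.basisFun (Fin 2) ℝ i) *
      fderiv ℝ ζ x (EuclideanSpace.basisFun (Fin 2) ℝ i) := by
  rw [← OrthonormalBasis.sum_inner_mul_inner (EuclideanSpace.basisFun (Fin 2) ℝ)]
  refine Finset.sum_congr rfl fun i _ => ?_
  rw [real_inner_comm (gradient ζ x)]
  simp only [gradient, InnerProductSpace.toDual_symm_apply]

lemma norm_gradient (u : Plane → ℝ) (x : Plane) : ‖gradient u x‖ = ‖fderiv ℝ u x‖ := by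
  simp [gradient]

/-- Green's formula for a `C¹` function against a test function. -/
lemma setIntegral_mul_laplacian {U : Set Plane} (hU : IsOpen U) {u ζ : Plane → ℝ}
    (hu : ContDiffOn ℝ 1 u U) (hζ : ContDiff ℝ ∞ ζ) (hK : HasCompactSupport ζ)
    (hKU : tsupport ζ ⊆ U) :
    ∫ x in U, u x * Laplacian.laplacian ζ x = -∫ x in U, inner ℝ (gradient u x) (gradient ζ x) := by
  set e := EuclideanSpace.basisFun (Fin 2) ℝ
  have hu' : ContinuousOn (fderiv ℝ u) U := hu.continuousOn_fderiv_of_isOpen hU (by norm_num)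
  have h1 : ∀ i, ContDiff ℝ ∞ (fun y => fderiv ℝ ζ y (e i)) := fun i =>
    (hζ.fderiv_right (m := ∞) (by simp)).clm_apply contDiff_const
  have h2 : ∀ i, tsupport (fun y => fderiv ℝ ζ y (e i)) ⊆ tsupport ζ := fun i =>
    tsupport_fderiv_apply_subset ℝ (e i)
  have h3 : ∀ i, HasCompactSupport (fun y => fderiv ℝ ζ y (e i)) := fun i =>
    hK.mono' (subset_closure.trans (h2 i))
  have h4 : ∀ i, tsupport (fun x => fderiv ℝ (fun y => fderiv ℝ ζ y (e i)) x (e i)) ⊆ tsupport ζ :=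
    fun i => (tsupport_fderiv_apply_subset ℝ (e i)).trans (h2 i)
  have h5 : ∀ i, HasCompactSupport (fun x => fderiv ℝ (fun y => fderiv ℝ ζ y (e i)) x (e i)) :=
    fun i => hK.mono' (subset_closure.trans (h4 i))
  have h6 : ∀ i, Continuous (fun x => fderiv ℝ (fun y => fderiv ℝ ζ y (e i)) x (e i)) :=
    fun i => ((h1 i).continuous_fderiv (by simp)).clm_apply continuous_const
  have i1 : ∀ i, Integrable (fun x => u x * fderiv ℝ (fun y => fderiv ℝ ζ y (e i)) x (e i)) :=
    fun i => integrable_mul_of_continuousOn hu.continuousOn (h6 i) (h5 i) ((h4 i).trans hKU)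
  have i2 : ∀ i, Integrable (fun x => fderiv ℝ u x (e i) * fderiv ℝ ζ x (e i)) :=
    fun i => integrable_mul_of_continuousOn (hu'.clm_apply continuousOn_const)
      (h1 i).continuous (h3 i) ((h2 i).trans hKU)
  have i3 : ∀ i, Integrable (fun x => u x * fderiv ℝ ζ x (e i)) :=
    fun i => integrable_mul_of_continuousOn hu.continuousOn
      (h1 i).continuous (h3 i) ((h2 i).trans hKU)
  have key : ∀ i, ∫ x, u x * fderiv ℝ (fun y => fderiv ℝ ζ y (e i)) x (e i)
      = -∫ x, fderiv ℝ u x (e i) * fderiv ℝ ζ x (e i) := by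
    intro i
    refine integral_mul_fderiv_eq_neg_fderiv_mul_of_integrable (i2 i) (i1 i) (i3 i) ?_ ?_
    · intro x hx
      exact (hu.differentiableOn (by norm_num)).differentiableAt
        (hU.mem_nhds (hKU (h2 i hx)))
    · intro x _
      exact ((h1 i).differentiable (by simp)).differentiableAt
  -- Off `U` both integrands vanish, so the integrals over `U` become integrals over the plane,
  -- where `key` applies.
  have z : ∀ x, x ∉ U → ∀ i, fderiv ℝ ζ x (e i) = 0 := fun x hx i =>
    image_eq_zero_of_notMem_tsupport (f := fun y => fderiv ℝ ζ y (e i)) fun h => hx (hKU (h2 i h))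
  have z' : ∀ x, x ∉ U → ∀ i, fderiv ℝ (fun y => fderiv ℝ ζ y (e i)) x (e i) = 0 := fun x hx i =>
    image_eq_zero_of_notMem_tsupport (f := fun x => fderiv ℝ (fun y => fderiv ℝ ζ y (e i)) x (e i))
      fun h => hx (hKU (h4 i h))
  simp_rw [laplacian_eq_sum_fderiv_fderiv (hζ.of_le (by norm_cast)), inner_gradient_eq_sum_fderiv]
  rw [setIntegral_eq_integral_of_forall_compl_eq_zero, setIntegral_eq_integral_of_forall_compl_eq_zero]
  · simp_rw [Finset.mul_sum]
    rw [integral_finsetSum _ fun i _ => i1 i, integral_finsetSum _ fun i _ => i2 i,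
      ← Finset.sum_neg_distrib]
    exact Finset.sum_congr rfl fun i _ => key i
  · intro x hx
    exact Finset.sum_eq_zero fun i _ => by rw [z x hx i, mul_zero]
  · intro x hx
    rw [Finset.sum_eq_zero fun i _ => z' x hx i, mul_zero]

/-- Green's formula against the constant `1`. It is what allows `v` to be replaced by `v - v 0` at
the singular point. -/
lemma integral_laplacian_eq_zero {ζ : Plane → ℝ} (hζ : ContDiff ℝ ∞ ζ) (hK : HasCompactSupport ζ) :
    ∫ x, Laplacian.laplacian ζ x = 0 := by
  have h := setIntegral_mul_laplacian isOpen_univ (u := fun _ => 1) contDiffOn_const hζ hK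
    (subset_univ _)
  have h0 : ∀ x : Plane, gradient (fun _ : Plane => (1 : ℝ)) x = 0 := fun x => by simp [gradient]
  simpa [h0] using h

lemma continuous_laplacian {ζ : Plane → ℝ} (hζ : ContDiff ℝ ∞ ζ) :
    Continuous (Laplacian.laplacian ζ) := by
  have h : Laplacian.laplacian ζ = fun x => _ :=
    funext fun x => laplacian_eq_sum_fderiv_fderiv (hζ.of_le (by norm_cast)) x
  rw [h]
  refine continuous_finsetSum _ fun i _ => ?_
  exact ((((hζ.fderiv_right (m := ∞) (by simp)).clm_apply contDiff_const).continuous_fderiv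
    (by simp)).clm_apply continuous_const)

lemma tsupport_laplacian_subset (ζ : Plane → ℝ) :
    tsupport (Laplacian.laplacian ζ) ⊆ tsupport ζ := by
  refine closure_minimal (fun x hx => ?_) (isClosed_tsupport ζ)
  by_contra h
  apply hx
  have : ζ =ᶠ[nhds x] fun _ => (0 : ℝ) := notMem_tsupport_iff_eventuallyEq.1 h
  rw [(InnerProductSpace.laplacian_congr_nhds this).eq_of_nhds]
  simp

/-! ### Energy estimate: from `e^{bu}` to `|∇u|^q` -/

/-- The energy inequality obtained by testing the equation with `ξ²`. -/
lemma setIntegral_gradient_rpow_mul_sq_le {a b m q : ℝ} (ha : 0 < a) (hm : 0 < m) (hq : 2 < q)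
    {U : Set Plane} (hU : IsOpen U) (hUfin : volume U ≠ ⊤) {u ξ : Plane → ℝ}
    (hu : ContDiffOn ℝ 1 u U) (hsol : IsDistributionalSolution a b m q u U)
    (hexp : IntegrableOn (fun x => Real.exp (b * u x)) U)
    (hξ : ContDiff ℝ ∞ ξ) (hK : HasCompactSupport ξ) (hKU : tsupport ξ ⊆ U)
    (h0 : ∀ x, 0 ≤ ξ x) (h1 : ∀ x, ξ x ≤ 1) :
    m / 2 * ∫ x in U, ‖gradient u x‖ ^ q * ξ x ^ 2 ≤
      a * (∫ x in U, Real.exp (b * u x)) + m / 2 * volume.real U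
        + 2 / m * ∫ x, ‖fderiv ℝ ξ x‖ ^ 2 := by
  have hζ : ContDiff ℝ ∞ (fun x => ξ x ^ 2) := hξ.pow 2
  have hζsub : tsupport (fun x => ξ x ^ 2) ⊆ tsupport ξ :=
    closure_mono fun x hx h => hx (by simp [h])
  have hζK : HasCompactSupport (fun x => ξ x ^ 2) := hK.mono' (subset_closure.trans hζsub)
  have hζU := hζsub.trans hKU
  have hdu : ContinuousOn (fderiv ℝ u) U := hu.continuousOn_fderiv_of_isOpen hU (by norm_num)
  have hG : ContinuousOn (fun x => ‖gradient u x‖ ^ q) U := by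
    simp_rw [norm_gradient]
    exact hdu.norm.rpow_const fun x _ => Or.inr (by linarith)
  have hE : ContinuousOn (fun x => Real.exp (b * u x)) U := by
    have := hu.continuousOn
    fun_prop
  have hlapsub := (tsupport_laplacian_subset fun x => ξ x ^ 2)
  have iL : Integrable (fun x => u x * Laplacian.laplacian (fun x => ξ x ^ 2) x) :=
    integrable_mul_of_continuousOn hu.continuousOn (continuous_laplacian hζ)
      (hζK.mono' (subset_closure.trans hlapsub)) (hlapsub.trans hζU)
  have iG : Integrable (fun x => ‖gradient u x‖ ^ q * ξ x ^ 2) :=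
    integrable_mul_of_continuousOn hG hζ.continuous hζK hζU
  have iE : Integrable (fun x => Real.exp (b * u x) * ξ x ^ 2) :=
    integrable_mul_of_continuousOn hE hζ.continuous hζK hζU
  have iξ : Integrable (fun x => ‖fderiv ℝ ξ x‖ ^ 2) := by
    refine Continuous.integrable_of_hasCompactSupport
      ((hξ.continuous_fderiv (by simp)).norm.pow 2) ?_
    exact (hK.fderiv (𝕜 := ℝ)).norm.comp_left (g := fun t : ℝ => t ^ 2) (by simp)
  have iEG : Integrable (fun x => a * (Real.exp (b * u x) * ξ x ^ 2)
      - m * (‖gradient u x‖ ^ q * ξ x ^ 2)) := (iE.const_mul a).sub (iG.const_mul m)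
  have hweak := hsol.2.2.2 _ hζ hζK hζU
  have e1 : ∀ x, -(u x * Laplacian.laplacian (fun x => ξ x ^ 2) x)
      + (a * Real.exp (b * u x) - m * ‖gradient u x‖ ^ q) * ξ x ^ 2
      = -(u x * Laplacian.laplacian (fun x => ξ x ^ 2) x) +
        (a * (Real.exp (b * u x) * ξ x ^ 2) - m * (‖gradient u x‖ ^ q * ξ x ^ 2)) :=
    fun x => by ring
  simp_rw [e1] at hweak
  rw [integral_add (f := fun x => -(u x * Laplacian.laplacian (fun x => ξ x ^ 2) x))
      iL.neg.integrableOn iEG.integrableOn,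
    integral_sub (iE.const_mul a).integrableOn (iG.const_mul m).integrableOn, integral_neg,
    integral_const_mul, integral_const_mul,
    setIntegral_mul_laplacian hU hu hζ hζK hζU, neg_neg] at hweak
  have hEle : ∫ x in U, Real.exp (b * u x) * ξ x ^ 2 ≤ ∫ x in U, Real.exp (b * u x) := by
    refine setIntegral_mono iE.integrableOn hexp fun x => ?_
    exact mul_le_of_le_one_right (Real.exp_nonneg _) (pow_le_one₀ (h0 x) (h1 x))
  have hfin : IntegrableOn (fun _ : Plane => m / 2) U := integrableOn_const hUfin
  have hpt : ∀ x, inner ℝ (gradient u x) (gradient (fun x => ξ x ^ 2) x) ≤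
      m / 2 + m / 2 * (‖gradient u x‖ ^ q * ξ x ^ 2) + 2 / m * ‖fderiv ℝ ξ x‖ ^ 2 := by
    intro x
    have hd : DifferentiableAt ℝ ξ x := (hξ.differentiable (by simp)).differentiableAt
    have hf : fderiv ℝ (fun x => ξ x ^ 2) x = (2 * ξ x) • fderiv ℝ ξ x := by
      have := (hd.hasFDerivAt.pow 2).fderiv
      simpa using this
    refine (real_inner_le_norm _ _).trans ?_
    rw [norm_gradient u, norm_gradient (fun x => ξ x ^ 2), hf, norm_smul, Real.norm_eq_abs,
      abs_of_nonneg (by linarith [h0 x])]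
    set A := ‖fderiv ℝ u x‖
    set B := ‖fderiv ℝ ξ x‖
    have hA : 0 ≤ A := norm_nonneg _
    -- For small gradients the square is at most `1`; for large ones `A² ≤ A^q`. This is where the
    -- exponent being above `2` enters.
    have hA2 : (ξ x * A) ^ 2 ≤ 1 + A ^ q * ξ x ^ 2 := by
      rcases le_total A 1 with h | h
      · have : 0 ≤ A ^ q * ξ x ^ 2 := by positivity
        have : (ξ x * A) ^ 2 ≤ 1 :=
          pow_le_one₀ (mul_nonneg (h0 x) hA) (mul_le_one₀ (h1 x) hA h)
        linarith
      · have : A ^ 2 ≤ A ^ q := by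
          rw [← Real.rpow_natCast]
          exact Real.rpow_le_rpow_of_exponent_le h (by exact_mod_cast hq.le)
        nlinarith [sq_nonneg (ξ x)]
    -- Young's inequality weighted so that only `m / 2` of the available `m` is spent on the
    -- gradient term; the rest survives on the left.
    have hY : A * (2 * ξ x * B) ≤ m / 2 * (ξ x * A) ^ 2 + 2 / m * B ^ 2 := by
      have : m / 2 * (ξ x * A) ^ 2 + 2 / m * B ^ 2 - A * (2 * ξ x * B)
        = 2 / m * (m / 2 * (ξ x * A) - B) ^ 2 := by field_simp; ring
      have h2 : 0 ≤ 2 / m * (m / 2 * (ξ x * A) - B) ^ 2 := by positivity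
      linarith
    nlinarith
  have hI : ∫ x in U, inner ℝ (gradient u x) (gradient (fun x => ξ x ^ 2) x) ≤
      m / 2 * volume.real U + m / 2 * (∫ x in U, ‖gradient u x‖ ^ q * ξ x ^ 2)
        + 2 / m * ∫ x, ‖fderiv ℝ ξ x‖ ^ 2 := by
    have iMG : IntegrableOn (fun x => m / 2 + m / 2 * (‖gradient u x‖ ^ q * ξ x ^ 2)) U :=
      hfin.add (iG.const_mul (m / 2)).integrableOn
    have h : ∫ x in U, inner ℝ (gradient u x) (gradient (fun x => ξ x ^ 2) x) ≤
        ∫ x in U, (m / 2 + m / 2 * (‖gradient u x‖ ^ q * ξ x ^ 2)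
          + 2 / m * ‖fderiv ℝ ξ x‖ ^ 2) := by
      have i3 := iMG.add (iξ.const_mul (2 / m)).integrableOn
      -- Integrability of the cross term need not be proved: otherwise its integral is `0` by
      -- convention, below a nonnegative bound.
      by_cases hint : IntegrableOn
          (fun x => inner ℝ (gradient u x) (gradient (fun x => ξ x ^ 2) x)) U
      · exact setIntegral_mono hint i3 hpt
      · rw [integral_undef hint]
        exact integral_nonneg fun x => by positivity
    rw [integral_add iMG
        (iξ.const_mul (2 / m)).integrableOn,
      integral_add hfin (iG.const_mul (m / 2)).integrableOn, integral_const_mul,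
      integral_const_mul, setIntegral_const, smul_eq_mul, mul_comm (volume.real U)] at h
    have h4 : ∫ x in U, ‖fderiv ℝ ξ x‖ ^ 2 ≤ ∫ x, ‖fderiv ℝ ξ x‖ ^ 2 :=
      setIntegral_le_integral iξ (Filter.Eventually.of_forall fun x => by positivity)
    have h5 : 2 / m * ∫ x in U, ‖fderiv ℝ ξ x‖ ^ 2 ≤ 2 / m * ∫ x, ‖fderiv ℝ ξ x‖ ^ 2 :=
      mul_le_mul_of_nonneg_left h4 (by positivity)
    linarith
  have := mul_le_mul_of_nonneg_left hEle ha.le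
  linarith

/-- The two-dimensional Dirichlet energy is invariant under scaling. -/
lemma integral_norm_fderiv_comp_smul_sq (η : Plane → ℝ) {R : ℝ} (hR : 0 < R) :
    ∫ x, ‖fderiv ℝ (fun y => η (R • y)) x‖ ^ 2 = ∫ x, ‖fderiv ℝ η x‖ ^ 2 := by
  simp_rw [fderiv_comp_smul, norm_smul, mul_pow]
  rw [integral_const_mul, Measure.integral_comp_smul volume (fun x => ‖fderiv ℝ η x‖ ^ 2)]
  simp only [finrank_euclideanSpace, Fintype.card_fin, smul_eq_mul, Real.norm_eq_abs, sq_abs]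
  rw [abs_of_pos (by positivity)]
  field_simp

/-- Cut-off functions of the punctured unit disk, with uniformly bounded Dirichlet energy,
converging to `1` near the origin. -/
lemma exists_punctured_cutoff : ∃ (C : ℝ) (ξ : ℕ → Plane → ℝ),
    (∀ n, ContDiff ℝ ∞ (ξ n)) ∧ (∀ n, HasCompactSupport (ξ n)) ∧
    (∀ n, tsupport (ξ n) ⊆ ball 0 1 \ {0}) ∧ (∀ n x, 0 ≤ ξ n x) ∧ (∀ n x, ξ n x ≤ 1) ∧
    (∀ n, ∫ x, ‖fderiv ℝ (ξ n) x‖ ^ 2 ≤ C) ∧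
    ∀ x ∈ ball (0 : Plane) (1 / 2) \ {0}, ∀ᶠ n in Filter.atTop, ξ n x = 1 := by
  let χ : ContDiffBump (0 : Plane) := ⟨1 / 2, 3 / 4, by norm_num, by norm_num⟩
  let η : ContDiffBump (0 : Plane) := ⟨1, 2, by norm_num, by norm_num⟩
  have hηs : ∀ R : ℝ, ContDiff ℝ ∞ fun x : Plane => η (R • x) := fun R =>
    η.contDiff.comp (contDiff_const_smul R)
  have hsm : ∀ n : ℕ, ContDiff ℝ ∞ (fun x => χ x * (1 - η (((n : ℝ) + 1) • x))) := fun n =>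
    χ.contDiff.mul (contDiff_const.sub (hηs _))
  have hts : ∀ n : ℕ, tsupport (fun x => χ x * (1 - η (((n : ℝ) + 1) • x))) ⊆ tsupport χ :=
    fun n => tsupport_mul_subset_left
  have iη : ∀ φ : Plane → ℝ, ContDiff ℝ ∞ φ → HasCompactSupport φ →
      Integrable (fun x => ‖fderiv ℝ φ x‖ ^ 2) := fun φ hφ hK =>
    Continuous.integrable_of_hasCompactSupport ((hφ.continuous_fderiv (by simp)).norm.pow 2)
      ((hK.fderiv (𝕜 := ℝ)).norm.comp_left (g := fun t : ℝ => t ^ 2) (by simp))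
  -- The factors `2` come from `(s + t)² ≤ 2s² + 2t²`; the `η` term does not depend on `n`, by scale
  -- invariance.
  refine ⟨2 * (∫ x, ‖fderiv ℝ χ x‖ ^ 2) + 2 * ∫ x, ‖fderiv ℝ η x‖ ^ 2,
    fun n x => χ x * (1 - η (((n : ℝ) + 1) • x)), hsm,
    fun n => χ.hasCompactSupport.mono' (subset_closure.trans (hts n)), ?_, ?_, ?_, ?_, ?_⟩
  · intro n x hx
    refine ⟨?_, ?_⟩
    · have := hts n hx
      rw [χ.tsupport_eq, mem_closedBall] at this
      rw [mem_ball]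
      refine this.trans_lt ?_
      change (3 / 4 : ℝ) < 1
      norm_num
    · rintro rfl
      refine (notMem_tsupport_iff_eventuallyEq.2 ?_) hx
      have h1 : Filter.Tendsto (fun x : Plane => ((n : ℝ) + 1) • x) (nhds 0) (nhds 0) := by
        have : Continuous (fun x : Plane => ((n : ℝ) + 1) • x) := by fun_prop
        simpa using this.tendsto 0
      filter_upwards [h1.eventually η.eventuallyEq_one] with y hy
      simp [hy]
  · exact fun n x => mul_nonneg χ.nonneg (by linarith [η.le_one (x := ((n : ℝ) + 1) • x)])
  · exact fun n x => mul_le_one₀ χ.le_one (by linarith [η.le_one (x := ((n : ℝ) + 1) • x)])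
      (by linarith [η.nonneg (x := ((n : ℝ) + 1) • x)])
  · intro n
    have hR : 0 < (n : ℝ) + 1 := by positivity
    have hK : HasCompactSupport fun x : Plane => η (((n : ℝ) + 1) • x) :=
      η.hasCompactSupport.comp_homeomorph (Homeomorph.smulOfNeZero _ hR.ne')
    have i1 := (iη _ χ.contDiff χ.hasCompactSupport).const_mul 2
    have i2 := (iη _ (hηs ((n : ℝ) + 1)) hK).const_mul 2
    have : ∫ x, ‖fderiv ℝ (fun x => χ x * (1 - η (((n : ℝ) + 1) • x))) x‖ ^ 2 ≤
        ∫ x, (2 * ‖fderiv ℝ χ x‖ ^ 2 +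
          2 * ‖fderiv ℝ (fun y => η (((n : ℝ) + 1) • y)) x‖ ^ 2) := by
      refine integral_mono (iη _ (hsm n)
        (χ.hasCompactSupport.mono' (subset_closure.trans (hts n)))) (i1.add i2) fun x => ?_
      have d1 : HasFDerivAt χ (fderiv ℝ χ x) x :=
        (χ.contDiff (n := 1)).differentiable (by norm_num) |>.differentiableAt.hasFDerivAt
      have d2 : HasFDerivAt (fun y : Plane => η (((n : ℝ) + 1) • y))
          (fderiv ℝ (fun y => η (((n : ℝ) + 1) • y)) x) x :=
        ((hηs ((n : ℝ) + 1)).differentiable (by simp)).differentiableAt.hasFDerivAt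
      have d3 := (d1.mul (d2.const_sub 1)).fderiv
      simp only at d3 ⊢
      erw [d3]
      set D2 := fderiv ℝ (fun y : Plane => η (((n : ℝ) + 1) • y)) x
      have hb : ‖χ x • -D2 + (1 - η (((n : ℝ) + 1) • x)) • fderiv ℝ χ x‖ ≤
          ‖D2‖ + ‖fderiv ℝ χ x‖ := by
        refine (norm_add_le _ _).trans ?_
        rw [norm_smul, norm_smul, norm_neg, Real.norm_of_nonneg χ.nonneg,
          Real.norm_of_nonneg (by linarith [η.le_one (x := ((n : ℝ) + 1) • x)])]
        refine add_le_add (mul_le_of_le_one_left (norm_nonneg _) χ.le_one)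
          (mul_le_of_le_one_left (norm_nonneg _)
            (by linarith [η.nonneg (x := ((n : ℝ) + 1) • x)]))
      have hb2 := pow_le_pow_left₀ (norm_nonneg _) hb 2
      nlinarith [sq_nonneg (‖D2‖ - ‖fderiv ℝ χ x‖)]
    rwa [integral_add i1 i2, integral_const_mul, integral_const_mul,
      integral_norm_fderiv_comp_smul_sq _ hR] at this
  · rintro x ⟨hx, hx0⟩
    have hx0 : 0 < ‖x‖ := norm_pos_iff.2 hx0
    -- From this `n` on, `(n + 1)‖x‖ ≥ 2`, the outer radius of `η`.
    filter_upwards [Filter.eventually_ge_atTop ⌈2 / ‖x‖⌉₊] with n hn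
    have h1 : χ x = 1 := χ.one_of_mem_closedBall (ball_subset_closedBall hx)
    have h2 : η (((n : ℝ) + 1) • x) = 0 := by
      refine η.zero_of_le_dist ?_
      rw [dist_zero_right, norm_smul, Real.norm_of_nonneg (by positivity)]
      change (2 : ℝ) ≤ _
      have : 2 / ‖x‖ ≤ n := (Nat.le_ceil _).trans (by exact_mod_cast hn)
      rw [div_le_iff₀ hx0] at this
      nlinarith
    rw [h1, h2]; norm_num

lemma uniqueDiffOn_closedBall_diff_zero : UniqueDiffOn ℝ (closedBall (0 : Plane) 1 \ {0}) := by
  rw [sdiff_eq]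
  refine (uniqueDiffOn_convex (convex_closedBall _ _) ?_).inter isOpen_compl_singleton
  rw [interior_closedBall _ one_ne_zero]
  exact nonempty_ball.2 one_pos

/-- Away from the origin `u` is `C¹` up to the unit circle, so the derivative is bounded on the
compact outer annulus. `fderivWithin` provides the continuity up to the circle, and agrees with
`fderiv` in the open disk. This reduces matters to the half disk, where the cutoffs tend to `1`. -/
lemma integrableOn_gradient_rpow_of_half {q : ℝ} (hq : 0 ≤ q) {u : Plane → ℝ}
    (hu : ContDiffOn ℝ 1 u (closedBall (0 : Plane) 1 \ {0}))
    (h : IntegrableOn (fun x => ‖gradient u x‖ ^ q) (ball 0 (1 / 2))) :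
    IntegrableOn (fun x => ‖gradient u x‖ ^ q) (ball 0 1) := by
  have hc := hu.continuousOn_fderivWithin uniqueDiffOn_closedBall_diff_zero le_rfl
  have hc' : ContinuousOn (fun x => ‖fderivWithin ℝ u (closedBall (0 : Plane) 1 \ {0}) x‖ ^ q)
      (closedBall 0 1 \ ball 0 (1 / 2)) :=
    (hc.norm.rpow_const fun x _ => Or.inr hq).mono
      (sdiff_subset_sdiff_right (singleton_subset_iff.2 (mem_ball_self (by norm_num))))
  have hcomp : IsCompact (closedBall (0 : Plane) 1 \ ball 0 (1 / 2)) :=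
    (isCompact_closedBall _ _).diff isOpen_ball
  have h2 : IntegrableOn (fun x => ‖gradient u x‖ ^ q) (ball 0 1 \ ball 0 (1 / 2)) := by
    refine ((hc'.integrableOn_compact hcomp).mono_set
      (sdiff_subset_sdiff_left ball_subset_closedBall)).congr_fun (fun x hx => ?_)
      (measurableSet_ball.diff measurableSet_ball)
    simp only
    rw [norm_gradient, fderivWithin_of_mem_nhds]
    have hx0 : x ≠ 0 := by
      rintro rfl
      exact hx.2 (mem_ball_self (by norm_num))
    exact Filter.mem_of_superset ((isOpen_ball.sdiff isClosed_singleton).mem_nhds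
      (show x ∈ ball (0 : Plane) 1 \ {0} from ⟨hx.1, hx0⟩)) (sdiff_subset_sdiff_left ball_subset_closedBall)
  exact (h.union h2).mono_set (by rw [union_sdiff_self]; exact subset_union_right)

/-- If `e^{bu}` is integrable then so is `|∇u|^q`. -/
lemma integrableOn_gradient_rpow_of_integrableOn_exp {a b m q : ℝ} (ha : 0 < a) (hm : 0 < m)
    (hq : 2 < q) {u : Plane → ℝ} (hu : ContDiffOn ℝ 1 u (closedBall (0 : Plane) 1 \ {0}))
    (hsol : IsDistributionalSolution a b m q u (ball (0 : Plane) 1 \ {0}))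
    (hexp : IntegrableOn (fun x => Real.exp (b * u x)) (ball (0 : Plane) 1)) :
    IntegrableOn (fun x => ‖gradient u x‖ ^ q) (ball 0 1) := by
  refine integrableOn_gradient_rpow_of_half (by linarith) hu ?_
  obtain ⟨C, ξ, hξ, hK, hKU, h0, h1, hC, hlim⟩ := exists_punctured_cutoff
  have hU : IsOpen (ball (0 : Plane) 1 \ {0}) := isOpen_ball.sdiff isClosed_singleton
  have hsub : ball (0 : Plane) 1 \ {0} ⊆ closedBall 0 1 \ {0} :=
    sdiff_subset_sdiff_left ball_subset_closedBall
  have hfin : volume (ball (0 : Plane) 1 \ {0}) ≠ ⊤ :=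
    ((measure_mono sdiff_subset).trans_lt measure_ball_lt_top).ne
  have key := fun n => setIntegral_gradient_rpow_mul_sq_le ha hm hq hU hfin (hu.mono hsub) hsol
    (hexp.mono_set sdiff_subset) (hξ n) (hK n) (hKU n) (h0 n) (h1 n)
  obtain ⟨M, hM⟩ : ∃ M, M = a * (∫ x in ball (0 : Plane) 1 \ {0}, Real.exp (b * u x))
    + m / 2 * volume.real (ball (0 : Plane) 1 \ {0}) + 2 / m * C := ⟨_, rfl⟩
  have key2 : ∀ n, ∫ x in ball (0 : Plane) 1 \ {0}, ‖gradient u x‖ ^ q * ξ n x ^ 2 ≤ M * 2 / m := by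
    intro n
    rw [le_div_iff₀ hm]
    have := mul_le_mul_of_nonneg_left (hC n) (show 0 ≤ 2 / m by positivity)
    linarith [key n, hM]
  have hmeas : Measurable (fun x => ‖gradient u x‖ ^ q) := by
    simp_rw [norm_gradient]
    exact (measurable_fderiv ℝ u).norm.pow_const q
  have hnn : ∀ n x, 0 ≤ ‖gradient u x‖ ^ q * ξ n x ^ 2 := fun n x => by positivity
  have hI : ∀ n, Integrable (fun x => ‖gradient u x‖ ^ q * ξ n x ^ 2) := by
    intro n
    have hsub' : tsupport (fun x => ξ n x ^ 2) ⊆ tsupport (ξ n) :=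
      closure_mono fun x hx h => hx (by simp [h])
    refine integrable_mul_of_continuousOn (U := ball (0 : Plane) 1 \ {0}) ?_ ((hξ n).continuous.pow 2)
      ((hK n).mono' (subset_closure.trans hsub')) (hsub'.trans (hKU n))
    simp_rw [norm_gradient]
    exact ((hu.mono hsub).continuousOn_fderiv_of_isOpen hU le_rfl).norm.rpow_const
      fun x _ => Or.inr (by linarith)
  refine ⟨hmeas.aestronglyMeasurable, ?_⟩
  rw [hasFiniteIntegral_iff_ofReal (Filter.Eventually.of_forall fun x => by positivity)]
  calc ∫⁻ x in ball (0 : Plane) (1 / 2), ENNReal.ofReal (‖gradient u x‖ ^ q)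
      = ∫⁻ x in ball (0 : Plane) (1 / 2) \ {0}, ENNReal.ofReal (‖gradient u x‖ ^ q) := by
        -- The cutoffs vanish at the origin for every `n`, so this null point is removed before
        -- taking pointwise limits.
        rw [setLIntegral_congr]
        exact (sdiff_null_ae_eq_self (by simp)).symm
    _ = ∫⁻ x in ball (0 : Plane) (1 / 2) \ {0}, Filter.liminf
          (fun n => ENNReal.ofReal (‖gradient u x‖ ^ q * ξ n x ^ 2)) Filter.atTop := by
        refine setLIntegral_congr_fun (measurableSet_ball.diff (measurableSet_singleton _))
          fun x hx => ?_
        refine (Filter.Tendsto.liminf_eq ?_).symm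
        refine tendsto_const_nhds.congr' ?_
        filter_upwards [hlim x hx] with n hn
        simp [hn]
    -- Fatou's lemma.
    _ ≤ Filter.liminf (fun n => ∫⁻ x in ball (0 : Plane) (1 / 2) \ {0},
          ENNReal.ofReal (‖gradient u x‖ ^ q * ξ n x ^ 2)) Filter.atTop :=
        lintegral_liminf_le fun n =>
          (hmeas.mul ((hξ n).continuous.measurable.pow_const 2)).ennreal_ofReal
    _ ≤ ENNReal.ofReal (M * 2 / m) := by
        refine Filter.liminf_le_of_frequently_le' (Filter.Eventually.of_forall fun n => ?_).frequently
        calc _ ≤ ∫⁻ x in ball (0 : Plane) 1 \ {0}, ENNReal.ofReal (‖gradient u x‖ ^ q * ξ n x ^ 2) :=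
              lintegral_mono_set (sdiff_subset_sdiff_left (ball_subset_ball (by norm_num)))
          _ = ENNReal.ofReal (∫ x in ball (0 : Plane) 1 \ {0}, ‖gradient u x‖ ^ q * ξ n x ^ 2) :=
              (ofReal_integral_eq_lintegral_ofReal (hI n).integrableOn
                (Filter.Eventually.of_forall (hnn n))).symm
          _ ≤ _ := ENNReal.ofReal_le_ofReal (key2 n)
    _ < ⊤ := ENNReal.ofReal_lt_top

/-! ### Morrey's inequality by averaging over segments -/

/-- The integral of `|∇u| |z - x|` along the segment from `x` to `z`. -/
noncomputable def segmentEnergy (u : Plane → ℝ) (x z : Plane) : ENNReal :=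
  ∫⁻ t in Icc (0 : ℝ) 1, ‖fderiv ℝ u (x + t • (z - x))‖ₑ * ‖z - x‖ₑ

lemma measurable_segmentEnergy_integrand (u : Plane → ℝ) (x : Plane) :
    Measurable fun p : Plane × ℝ => ‖fderiv ℝ u (x + p.2 • (p.1 - x))‖ₑ * ‖p.1 - x‖ₑ := by
  have h := (measurable_fderiv ℝ u).enorm
  have h2 : Measurable fun p : Plane × ℝ => x + p.2 • (p.1 - x) :=
    Continuous.measurable (by fun_prop)
  have h3 : Measurable fun p : Plane × ℝ => p.1 - x := Continuous.measurable (by fun_prop)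
  exact (h.comp h2).mul h3.enorm

lemma measurable_segmentEnergy (u : Plane → ℝ) (x : Plane) : Measurable (segmentEnergy u x) :=
  (measurable_segmentEnergy_integrand u x).lintegral_prod_right'

lemma segment_mem_ball {x z : Plane} (hx : x ∈ closedBall (0 : Plane) 1)
    (hz : z ∈ ball (0 : Plane) 1) {t : ℝ} (h0 : 0 < t) (h1 : t ≤ 1) :
    x + t • (z - x) ∈ ball (0 : Plane) 1 := by
  rw [mem_closedBall_zero_iff] at hx
  rw [mem_ball_zero_iff] at hz ⊢
  have : x + t • (z - x) = (1 - t) • x + t • z := by module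
  rw [this]
  refine (norm_add_le _ _).trans_lt ?_
  rw [norm_smul, norm_smul, Real.norm_of_nonneg h0.le, Real.norm_of_nonneg (by linarith)]
  nlinarith

/-- The fundamental theorem of calculus along the segment. The base point may lie on the unit
circle, where `fderiv` need not be the one-sided derivative, so the parameter `t = 0` is discarded;
every later point is interior. -/
lemma enorm_sub_le_segmentEnergy {u : Plane → ℝ}
    (hu : ContDiffOn ℝ 1 u (closedBall (0 : Plane) 1 \ {0})) {x z : Plane}
    (hx : x ∈ closedBall (0 : Plane) 1) (hz : z ∈ ball (0 : Plane) 1)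
    (hxz : ∀ t : ℝ, x + t • (z - x) ≠ 0) : ‖u z - u x‖ₑ ≤ segmentEnergy u x z := by
  have hγ : ContDiff ℝ 1 fun t : ℝ => x + t • (z - x) := by fun_prop
  have hmem : ∀ t ∈ Icc (0 : ℝ) 1, x + t • (z - x) ∈ closedBall (0 : Plane) 1 \ {0} := by
    intro t ht
    refine ⟨?_, hxz t⟩
    rcases ht.1.eq_or_lt with rfl | h
    · simpa using hx
    · exact ball_subset_closedBall (segment_mem_ball hx hz h ht.2)
  have h1 : ContDiffOn ℝ 1 (fun t : ℝ => u (x + t • (z - x))) (Icc 0 1) :=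
    hu.comp hγ.contDiffOn hmem
  have h2 := enorm_sub_le_lintegral_deriv_of_contDiffOn_Icc h1 zero_le_one
  simp only [one_smul, zero_smul, add_zero, add_sub_cancel] at h2
  refine h2.trans ?_
  unfold segmentEnergy
  rw [← restrict_Ioc_eq_restrict_Icc]
  refine setLIntegral_mono' measurableSet_Ioc fun t ht => ?_
  have hball := segment_mem_ball hx hz ht.1 ht.2
  have hnhds : closedBall (0 : Plane) 1 \ {0} ∈ nhds (x + t • (z - x)) :=
    Filter.mem_of_superset ((isOpen_ball.sdiff isClosed_singleton).mem_nhds ⟨hball, hxz t⟩)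
      (sdiff_subset_sdiff_left ball_subset_closedBall)
  have hd : DifferentiableAt ℝ u (x + t • (z - x)) :=
    (hu.contDiffAt hnhds).differentiableAt (by norm_num)
  have hγd : HasDerivAt (fun t : ℝ => x + t • (z - x)) (z - x) t := by
    simpa using ((hasDerivAt_id t).smul_const (z - x)).const_add x
  have := (hd.hasFDerivAt.comp_hasDerivAt t hγd).deriv
  simp only [Function.comp_def] at this
  rw [this]
  exact ContinuousLinearMap.le_opENorm _ _

/-- If the line through `x` and `z` meets the origin, then `z` lies in the span of `x`, a proper
subspace and hence a null set. -/
lemma ae_segment_ne_zero {x : Plane} (hx : x ≠ 0) :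
    ∀ᵐ z : Plane, ∀ t : ℝ, x + t • (z - x) ≠ 0 := by
  have h : volume (Submodule.span ℝ {x} : Set Plane) = 0 := by
    refine Measure.addHaar_submodule _ _ fun h => ?_
    have := finrank_span_singleton (K := ℝ) hx
    rw [h, finrank_top, finrank_euclideanSpace, Fintype.card_fin] at this
    omega
  filter_upwards [measure_eq_zero_iff_ae_notMem.1 h] with z hz t ht
  apply hz
  have ht0 : t ≠ 0 := by
    rintro rfl
    simp [hx] at ht
  have hz' : z = (1 - t⁻¹) • x := by
    have h2 : t⁻¹ • (x + t • (z - x)) = 0 := by rw [ht, smul_zero]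
    rw [smul_add, smul_smul, inv_mul_cancel₀ ht0, one_smul] at h2
    rw [sub_smul, one_smul]
    have : z = x - t⁻¹ • x + (t⁻¹ • x + (z - x)) := by abel
    rw [this, h2, add_zero]
  rw [hz']
  exact Submodule.smul_mem _ _ (Submodule.mem_span_singleton_self x)

lemma lintegral_comp_smul_add {G : Plane → ENNReal} (hG : Measurable G) {t : ℝ} (ht : 0 < t)
    (c : Plane) : ∫⁻ z, G (c + t • z) = ENNReal.ofReal (t ^ (-2 : ℝ)) * ∫⁻ z, G z := by
  have h1 : ∫⁻ z, G (c + t • z) = ∫⁻ y, G (c + y) ∂(Measure.map (t • ·) volume) :=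
    (lintegral_map (hG.comp (measurable_const_add c)) (measurable_const_smul t)).symm
  rw [h1, Measure.map_addHaar_smul _ ht.ne', lintegral_smul_measure, smul_eq_mul,
    lintegral_add_left_eq_self (fun z => G z) c]
  congr 2
  rw [finrank_euclideanSpace, Fintype.card_fin, abs_of_pos (by positivity), Real.rpow_neg ht.le]
  norm_cast

/-- Hölder's inequality on `D`, then the change of variables `z ↦ x + t(z - x)`: this homothety
keeps `D` in the unit disk and has Jacobian `t²`, whose `1/q`-th power gives the factor `t^{-2/q}`.
-/
lemma lintegral_fderiv_homothety_le {u : Plane → ℝ} {q : ℝ} (hq : 2 < q) {D : Set Plane}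
    (hD : MeasurableSet D) (hDB : D ⊆ ball 0 1) {x : Plane} (hx : x ∈ closedBall (0 : Plane) 1)
    {t : ℝ} (h0 : 0 < t) (h1 : t ≤ 1) :
    ∫⁻ z in D, ‖fderiv ℝ u (x + t • (z - x))‖ₑ ≤
      ENNReal.ofReal (t ^ (-(2 / q))) * ((∫⁻ y in ball (0 : Plane) 1, ‖fderiv ℝ u y‖ₑ ^ q) ^ (1 / q)
        * volume D ^ (1 - 1 / q)) := by
  have hq0 : 0 < q := by linarith
  have hpq : q.HolderConjugate (q / (q - 1)) := Real.HolderConjugate.conjExponent (by linarith)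
  have hg := (measurable_fderiv ℝ u).enorm
  have hpath : Measurable fun z : Plane => x + t • (z - x) := Continuous.measurable (by fun_prop)
  have hH := ENNReal.lintegral_mul_le_Lp_mul_Lq (volume.restrict D) hpq
    (f := fun z => ‖fderiv ℝ u (x + t • (z - x))‖ₑ) (g := fun _ => 1)
    (hg.comp hpath).aemeasurable aemeasurable_const
  simp only [Pi.mul_apply, mul_one, ENNReal.one_rpow, lintegral_const, one_mul,
    Measure.restrict_apply_univ] at hH
  have e : 1 / (q / (q - 1)) = 1 - 1 / q := by
    have : q - 1 ≠ 0 := by linarith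
    field_simp
  rw [e] at hH
  refine hH.trans ?_
  rw [← mul_assoc]
  refine mul_le_mul_left ?_ _
  -- Extension by zero lets the change of variables run over the whole plane.
  set G : Plane → ENNReal := (ball (0 : Plane) 1).indicator fun y => ‖fderiv ℝ u y‖ₑ ^ q
  have hGm : Measurable G := (hg.pow_const q).indicator measurableSet_ball
  have h2 : ∫⁻ z in D, ‖fderiv ℝ u (x + t • (z - x))‖ₑ ^ q ≤
      ENNReal.ofReal (t ^ (-2 : ℝ)) * ∫⁻ y in ball (0 : Plane) 1, ‖fderiv ℝ u y‖ₑ ^ q := by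
    rw [← lintegral_indicator measurableSet_ball, ← lintegral_comp_smul_add hGm h0 ((1 - t) • x)]
    refine (setLIntegral_mono' hD fun z hz => ?_).trans (setLIntegral_le_lintegral D _)
    have e2 : (1 - t) • x + t • z = x + t • (z - x) := by module
    rw [e2]
    simp only [G]
    rw [indicator_of_mem (segment_mem_ball hx (hDB hz) h0 h1)]
  refine (ENNReal.rpow_le_rpow h2 (by positivity)).trans_eq ?_
  rw [ENNReal.mul_rpow_of_nonneg _ _ (by positivity), ENNReal.ofReal_rpow_of_pos (by positivity),
    ← Real.rpow_mul h0.le]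
  congr 3
  ring

/-- Tonelli exchanges the average over `z` with the integral along the segments. The remaining
`t`-integral is finite because `2/q < 1`. -/
lemma setLIntegral_segmentEnergy_le {u : Plane → ℝ} {q d : ℝ} (hq : 2 < q) {D : Set Plane}
    (hD : MeasurableSet D) (hDB : D ⊆ ball 0 1) {x : Plane} (hx : x ∈ closedBall (0 : Plane) 1)
    (hd : ∀ z ∈ D, ‖z - x‖ ≤ d) :
    ∫⁻ z in D, segmentEnergy u x z ≤ (∫⁻ t in Icc (0 : ℝ) 1, ENNReal.ofReal (t ^ (-(2 / q)))) *
      ((∫⁻ y in ball (0 : Plane) 1, ‖fderiv ℝ u y‖ₑ ^ q) ^ (1 / q) * volume D ^ (1 - 1 / q))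
        * ENNReal.ofReal d := by
  unfold segmentEnergy
  rw [lintegral_lintegral_swap (measurable_segmentEnergy_integrand u x).aemeasurable]
  calc _ ≤ ∫⁻ t in Icc (0 : ℝ) 1, (ENNReal.ofReal (t ^ (-(2 / q))) *
        ((∫⁻ y in ball (0 : Plane) 1, ‖fderiv ℝ u y‖ₑ ^ q) ^ (1 / q) * volume D ^ (1 - 1 / q)))
        * ENNReal.ofReal d := by
        rw [← restrict_Ioc_eq_restrict_Icc]
        refine setLIntegral_mono' measurableSet_Ioc fun t ht => ?_
        refine le_trans ?_ (mul_le_mul_left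
          (lintegral_fderiv_homothety_le (u := u) hq hD hDB hx ht.1 ht.2) _)
        rw [← lintegral_mul_const' _ _ ENNReal.ofReal_ne_top]
        refine setLIntegral_mono' hD fun z hz => ?_
        refine mul_le_mul_right ?_ _
        rw [← ofReal_norm]
        exact ENNReal.ofReal_le_ofReal (hd z hz)
    _ = _ := by
        rw [lintegral_mul_const' _ _ ENNReal.ofReal_ne_top, lintegral_mul_const]
        exact (measurable_id.pow_const _).ennreal_ofReal

/-- A point at distance comparable to `|x - y|` from both `x` and `y` which is the centre of a
ball of comparable radius contained in the unit disk. -/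
lemma exists_ball_near_pair {x y : Plane} (hx : x ∈ closedBall (0 : Plane) 1)
    (hy : y ∈ closedBall (0 : Plane) 1) (hxy : x ≠ y) :
    ∃ c, ball c (‖x - y‖ / 4) ⊆ ball 0 1 ∧ (∀ z ∈ ball c (‖x - y‖ / 4), ‖z - x‖ ≤ ‖x - y‖) ∧
      ∀ z ∈ ball c (‖x - y‖ / 4), ‖z - y‖ ≤ ‖x - y‖ := by
  rw [mem_closedBall_zero_iff] at hx hy
  set d := ‖x - y‖
  have hd0 : 0 < d := norm_pos_iff.2 (sub_ne_zero.2 hxy)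
  have hd2 : d ≤ 2 := (norm_sub_le x y).trans (by linarith)
  -- The centre is the midpoint shrunk by `1 - d/4`, which leaves room for radius `d/4` inside the
  -- disk. It moves by at most `d/4`, so distances to `x` and `y` stay below `d/4 + d/4 + d/2 = d`.
  set p : Plane := (1 / 2 : ℝ) • (x + y)
  have hp : ‖p‖ ≤ 1 := by
    rw [norm_smul, Real.norm_of_nonneg (by norm_num)]
    linarith [norm_add_le x y]
  have hpx : ‖p - x‖ = d / 2 := by
    have : p - x = (1 / 2 : ℝ) • (y - x) := by simp only [p]; module
    rw [this, norm_smul, Real.norm_of_nonneg (by norm_num), norm_sub_rev]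
    ring
  have hpy : ‖p - y‖ = d / 2 := by
    have : p - y = (1 / 2 : ℝ) • (x - y) := by simp only [p]; module
    rw [this, norm_smul, Real.norm_of_nonneg (by norm_num)]
    ring
  have hcp : ‖(1 - d / 4) • p - p‖ ≤ d / 4 := by
    have : (1 - d / 4) • p - p = (-(d / 4)) • p := by module
    rw [this, norm_smul, norm_neg, Real.norm_of_nonneg (by linarith)]
    nlinarith
  have near : ∀ w, ‖p - w‖ = d / 2 → ∀ z ∈ ball ((1 - d / 4) • p) (d / 4), ‖z - w‖ ≤ d := by
    intro w hw z hz
    rw [mem_ball_iff_norm] at hz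
    have e : z - w = (z - (1 - d / 4) • p) + ((1 - d / 4) • p - p) + (p - w) := by abel
    rw [e]
    linarith [norm_add₃_le (a := z - (1 - d / 4) • p) (b := (1 - d / 4) • p - p) (c := p - w)]
  refine ⟨(1 - d / 4) • p, fun z hz => ?_, near x hpx, near y hpy⟩
  rw [mem_ball_iff_norm] at hz
  rw [mem_ball_zero_iff]
  have e : z = (z - (1 - d / 4) • p) + (1 - d / 4) • p := by abel
  have h3 : ‖(1 - d / 4) • p‖ ≤ 1 - d / 4 := by
    rw [norm_smul, Real.norm_of_nonneg (by linarith)]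
    nlinarith
  rw [e]
  linarith [norm_add_le (z - (1 - d / 4) • p) ((1 - d / 4) • p)]

lemma lintegral_Icc_rpow_lt_top {r : ℝ} (hr : -1 < r) :
    ∫⁻ t in Icc (0 : ℝ) 1, ENNReal.ofReal (t ^ r) < ⊤ := by
  have h : IntegrableOn (fun t : ℝ => t ^ r) (Icc 0 1) := by
    have := intervalIntegral.intervalIntegrable_rpow' (a := 0) (b := 1) hr
    rwa [intervalIntegrable_iff_integrableOn_Icc_of_le zero_le_one] at this
  exact (setLIntegral_mono' measurableSet_Icc fun t _ =>
    Real.ofReal_le_enorm _).trans_lt h.2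

/-- Morrey's inequality in the punctured disk. -/
lemma exists_holderOnWith_of_integrableOn_gradient_rpow {q : ℝ} (hq : 2 < q) {u : Plane → ℝ}
    (hu : ContDiffOn ℝ 1 u (closedBall (0 : Plane) 1 \ {0}))
    (hint : IntegrableOn (fun x => ‖gradient u x‖ ^ q) (ball 0 1)) :
    ∃ C α : NNReal, 0 < α ∧ α ≤ 1 ∧ HolderOnWith C α u (closedBall (0 : Plane) 1 \ {0}) := by
  have hq0 : 0 < q := by linarith
  have hα : 0 < 1 - 2 / q := by
    rw [sub_pos, div_lt_one hq0]; exact hq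
  have hα1 : 1 - 2 / q ≤ 1 := by
    have : 0 < 2 / q := by positivity
    linarith
  obtain ⟨N, hN⟩ : ∃ N, N = ∫⁻ y in ball (0 : Plane) 1, ‖fderiv ℝ u y‖ₑ ^ q := ⟨_, rfl⟩
  have hNtop : N ≠ ⊤ := by
    rw [hN]
    refine ne_of_lt (lt_of_le_of_lt (lintegral_mono fun y => ?_) hint.2)
    simp only [norm_gradient]
    rw [Real.enorm_rpow_of_nonneg (norm_nonneg _) hq0.le, enorm_norm]
  obtain ⟨K, hK⟩ : ∃ K, K = ∫⁻ t in Icc (0 : ℝ) 1, ENNReal.ofReal (t ^ (-(2 / q))) := ⟨_, rfl⟩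
  have hKtop : K ≠ ⊤ := by
    rw [hK]
    exact (lintegral_Icc_rpow_lt_top (by linarith)).ne
  set V := volume.real (ball (0 : Plane) 1)
  have hV : 0 < V := ENNReal.toReal_pos (measure_ball_pos _ _ one_pos).ne' measure_ball_lt_top.ne
  -- The `2` counts the segments from `x` and from `y`; `V * (1 / 4) ^ 2` is the area of the
  -- averaging ball divided by `d²`.
  set M : ℝ := 2 * K.toReal * (N.toReal ^ (1 / q)) * (V * (1 / 4) ^ 2) ^ (-(1 / q))
  have hM : 0 ≤ M := by positivity
  refine ⟨⟨M, hM⟩, ⟨1 - 2 / q, hα.le⟩, hα, hα1, fun x hx y hy => ?_⟩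
  rcases eq_or_ne x y with rfl | hxy
  · simp
  obtain ⟨c, hc1, hcx, hcy⟩ := exists_ball_near_pair hx.1 hy.1 hxy
  set d := ‖x - y‖
  have hd0 : 0 < d := norm_pos_iff.2 (sub_ne_zero.2 hxy)
  have hvol : volume.real (ball c (d / 4)) = V * (1 / 4) ^ 2 * d ^ 2 := by
    rw [measureReal_def, Measure.addHaar_ball _ _ (by positivity), ENNReal.toReal_mul,
      ENNReal.toReal_ofReal (by positivity), finrank_euclideanSpace, Fintype.card_fin]
    change _ * V = _
    ring
  have hpt : ∀ᵐ z ∂(volume.restrict (ball c (d / 4))),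
      ‖u x - u y‖ₑ ≤ segmentEnergy u x z + segmentEnergy u y z := by
    rw [ae_restrict_iff' measurableSet_ball]
    filter_upwards [ae_segment_ne_zero hx.2, ae_segment_ne_zero hy.2] with z h1 h2 hz
    have e : u x - u y = (u z - u y) - (u z - u x) := by ring
    rw [e, add_comm]
    exact (enorm_sub_le).trans (add_le_add (enorm_sub_le_segmentEnergy hu hy.1 (hc1 hz) h2)
      (enorm_sub_le_segmentEnergy hu hx.1 (hc1 hz) h1))
  have hI := lintegral_mono_ae hpt
  rw [lintegral_const, Measure.restrict_apply_univ,
    lintegral_add_left (measurable_segmentEnergy u x)] at hI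
  have hI2 := hI.trans (add_le_add
    (setLIntegral_segmentEnergy_le (u := u) hq measurableSet_ball hc1 hx.1 hcx)
    (setLIntegral_segmentEnergy_le (u := u) hq measurableSet_ball hc1 hy.1 hcy))
  rw [← hN, ← hK, ← two_mul] at hI2
  have hfin : 2 * (K * (N ^ (1 / q) * volume (ball c (d / 4)) ^ (1 - 1 / q)) * ENNReal.ofReal d)
      ≠ ⊤ := by
    have hq1 : 1 / q ≤ 1 := by rw [div_le_one hq0]; linarith
    refine ENNReal.mul_ne_top (by norm_num) (ENNReal.mul_ne_top (ENNReal.mul_ne_top hKtop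
      (ENNReal.mul_ne_top (ENNReal.rpow_ne_top_of_nonneg (by positivity) hNtop)
        (ENNReal.rpow_ne_top_of_nonneg (by linarith) measure_ball_lt_top.ne)))
      ENNReal.ofReal_ne_top)
  have hR := ENNReal.toReal_mono hfin hI2
  simp only [ENNReal.toReal_mul, ← ENNReal.toReal_rpow, toReal_enorm, ← measureReal_def,
    ENNReal.toReal_ofReal hd0.le, ENNReal.toReal_ofNat] at hR
  rw [hvol] at hR
  have hW : 0 < V * (1 / 4) ^ 2 := by positivity
  set W := V * (1 / 4) ^ 2
  have hvp : 0 < W * d ^ 2 := by positivity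
  -- Factoring out the area `W * d ^ 2` leaves `d^{-2/q}`, which joins the segment length `d` to
  -- form the Hölder exponent `1 - 2/q`.
  have e1 : (W * d ^ 2) ^ (1 - 1 / q) = (W * d ^ 2) * (W ^ (-(1 / q)) * d ^ (-(2 / q))) := by
    rw [sub_eq_add_neg, Real.rpow_add hvp, Real.rpow_one, Real.mul_rpow hW.le (by positivity),
      ← Real.rpow_natCast d 2, ← Real.rpow_mul hd0.le]
    congr 3
    push_cast
    ring
  have e2 : d ^ (1 - 2 / q) = d * d ^ (-(2 / q)) := by
    rw [sub_eq_add_neg, Real.rpow_add hd0, Real.rpow_one]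
  have hfinal : ‖u x - u y‖ ≤ M * d ^ (1 - 2 / q) := by
    refine le_of_mul_le_mul_right (hR.trans_eq ?_) hvp
    rw [e1, e2]
    simp only [M]
    ring
  rw [edist_dist, edist_dist, dist_eq_norm, dist_eq_norm,
    ENNReal.ofReal_rpow_of_pos hd0]
  refine (ENNReal.ofReal_le_ofReal hfinal).trans_eq ?_
  rw [ENNReal.ofReal_mul hM]
  congr 1
  exact ENNReal.ofReal_eq_coe_nnreal hM

/-! ### Extension to the origin and removability -/

lemma zero_mem_closure_closedBall_diff_zero :
    (0 : Plane) ∈ closure (closedBall (0 : Plane) 1 \ {0}) := by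
  have h : (nhdsWithin (0 : Plane) {0}ᶜ).NeBot := inferInstance
  rw [mem_closure_iff_nhdsWithin_neBot, sdiff_eq, nhdsWithin_inter',
    nhdsWithin_eq_nhds.2 (closedBall_mem_nhds _ one_pos)]
  exact h

/-- A Hölder function on the punctured disk extends to the disk. -/
lemma HolderOnWith.exists_extension_zero {C α : NNReal} (hα : 0 < α) {u : Plane → ℝ}
    (h : HolderOnWith C α u (closedBall (0 : Plane) 1 \ {0})) :
    ∃ v, EqOn v u (closedBall (0 : Plane) 1 \ {0}) ∧ HolderOnWith C α v (closedBall 0 1) := by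
  have hne : (nhdsWithin (0 : Plane) (closedBall (0 : Plane) 1 \ {0})).NeBot :=
    mem_closure_iff_nhdsWithin_neBot.1 zero_mem_closure_closedBall_diff_zero
  obtain ⟨L, hL⟩ : ∃ L, Filter.Tendsto u (nhdsWithin 0 (closedBall (0 : Plane) 1 \ {0})) (nhds L) := by
    -- Hölder continuity is uniform continuity, so the values near the origin form a Cauchy filter.
    have hc : Cauchy (Filter.map u (nhdsWithin 0 (closedBall (0 : Plane) 1 \ {0}))) :=
      (cauchy_nhds.mono nhdsWithin_le_nhds).map_of_le (h.uniformContinuousOn hα)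
        (Filter.le_principal_iff.2 self_mem_nhdsWithin)
    exact CompleteSpace.complete hc
  have hv : ∀ x, x ≠ 0 → Function.update u 0 L x = u x := fun x hx => Function.update_of_ne hx _ _
  -- The Hölder bound between `z` and `y` passes to the limit `z → 0`.
  have h0 : ∀ y ∈ closedBall (0 : Plane) 1 \ {0}, edist L (u y) ≤ C * edist 0 y ^ (α : ℝ) := by
    intro y hy
    have t1 := (hL.edist (tendsto_const_nhds (x := u y)))
    have t2 : Filter.Tendsto (fun z : Plane => (C : ENNReal) * edist z y ^ (α : ℝ))
        (nhdsWithin 0 (closedBall (0 : Plane) 1 \ {0})) (nhds (C * edist 0 y ^ (α : ℝ))) := by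
      refine ENNReal.Tendsto.const_mul ?_ (Or.inr ENNReal.coe_ne_top)
      have : Continuous fun z : Plane => edist z y ^ (α : ℝ) :=
        ENNReal.continuous_rpow_const.comp (by fun_prop)
      exact (this.tendsto 0).mono_left nhdsWithin_le_nhds
    refine le_of_tendsto_of_tendsto t1 t2 ?_
    filter_upwards [self_mem_nhdsWithin] with z hz
    exact h z hz y hy
  refine ⟨Function.update u 0 L, fun x hx => hv x hx.2, fun x hx y hy => ?_⟩
  rcases eq_or_ne x 0 with rfl | hx0 <;> rcases eq_or_ne y 0 with rfl | hy0
  · simp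
  · rw [Function.update_self, hv y hy0]
    exact h0 y ⟨hy, hy0⟩
  · rw [Function.update_self, hv x hx0, edist_comm, edist_comm x]
    exact h0 x ⟨hx, hx0⟩
  · rw [hv x hx0, hv y hy0]
    exact h x ⟨hx, hx0⟩ y ⟨hy, hy0⟩

lemma abs_laplacian_le (ζ : Plane → ℝ) (x : Plane) :
    |Laplacian.laplacian ζ x| ≤ 2 * ‖iteratedFDeriv ℝ 2 ζ x‖ := by
  rw [InnerProductSpace.laplacian_eq_iteratedFDeriv_orthonormalBasis ζ
    (EuclideanSpace.basisFun (Fin 2) ℝ)]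
  refine (Finset.abs_sum_le_sum_abs _ _).trans ?_
  have h : ∀ i ∈ Finset.univ, |iteratedFDeriv ℝ 2 ζ x ![EuclideanSpace.basisFun (Fin 2) ℝ i,
      EuclideanSpace.basisFun (Fin 2) ℝ i]| ≤ ‖iteratedFDeriv ℝ 2 ζ x‖ := by
    intro i _
    refine ((iteratedFDeriv ℝ 2 ζ x).le_opNorm _).trans_eq ?_
    simp [Fin.prod_univ_two]
  refine (Finset.sum_le_card_nsmul _ _ _ h).trans_eq ?_
  simp

lemma exists_bound_iteratedFDeriv {ζ : Plane → ℝ} (hζ : ContDiff ℝ ∞ ζ) (hK : HasCompactSupport ζ)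
    (N : ℕ) : ∃ K, 0 ≤ K ∧ ∀ i ≤ N, ∀ x, ‖iteratedFDeriv ℝ i ζ x‖ ≤ K := by
  have h : ∀ i, ∃ K, ∀ x, ‖iteratedFDeriv ℝ i ζ x‖ ≤ K := fun i =>
    (hζ.continuous_iteratedFDeriv (m := i) (by exact_mod_cast le_top)).bounded_above_of_compact_support
      (hK.iteratedFDeriv i)
  choose K hK using h
  have h0 : ∀ i, 0 ≤ K i := fun i => (norm_nonneg _).trans (hK i 0)
  exact ⟨∑ i ∈ Finset.range (N + 1), K i, Finset.sum_nonneg fun i _ => h0 i, fun i hi x =>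
    (hK i x).trans (Finset.single_le_sum (fun j _ => h0 j) (Finset.mem_range.2 (by omega)))⟩

/-- Multiplying by a function concentrated at scale `1/R` costs at most `R²` in the Laplacian. -/
lemma exists_bound_laplacian_mul_comp_smul {ζ η : Plane → ℝ} (hζ : ContDiff ℝ ∞ ζ)
    (hζK : HasCompactSupport ζ) (hη : ContDiff ℝ ∞ η) (hηK : HasCompactSupport η) :
    ∃ K, 0 ≤ K ∧ ∀ R : ℝ, 1 ≤ R → ∀ x,
      |Laplacian.laplacian (fun y => ζ y * η (R • y)) x| ≤ K * R ^ 2 := by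
  obtain ⟨K₁, hK₁, h₁⟩ := exists_bound_iteratedFDeriv hζ hζK 2
  obtain ⟨K₂, hK₂, h₂⟩ := exists_bound_iteratedFDeriv hη hηK 2
  refine ⟨2 * ∑ i ∈ Finset.range 3, (Nat.choose 2 i : ℝ) * K₁ * K₂, by positivity,
    fun R hR x => ?_⟩
  have hηR : ContDiff ℝ ∞ fun y : Plane => η (R • y) := hη.comp (contDiff_const_smul R)
  refine (abs_laplacian_le _ x).trans ?_
  rw [mul_assoc]
  refine mul_le_mul_of_nonneg_left ?_ (by norm_num)
  refine (norm_iteratedFDeriv_mul_le hζ hηR x (n := 2) (by norm_cast)).trans ?_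
  rw [Finset.sum_mul]
  refine Finset.sum_le_sum fun i hi => ?_
  have hi2 : i ≤ 2 := by simpa [Nat.lt_succ_iff] using hi
  have h3 : ‖iteratedFDeriv ℝ (2 - i) (fun y : Plane => η (R • y)) x‖ ≤ K₂ * R ^ 2 := by
    rw [iteratedFDeriv_comp_const_smul R (contDiff_infty.1 hη (2 - i)), norm_smul, norm_pow,
      Real.norm_of_nonneg (by linarith), mul_comm]
    exact mul_le_mul (h₂ _ (by omega) _) (pow_le_pow_right₀ hR (by omega)) (by positivity) hK₂
  calc _ ≤ (Nat.choose 2 i : ℝ) * K₁ * (K₂ * R ^ 2) :=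
        mul_le_mul (mul_le_mul_of_nonneg_left (h₁ i hi2 x) (by positivity)) h3 (norm_nonneg _)
          (by positivity)
    _ = _ := by ring

/-- A point is removable for the Poisson equation with integrable right-hand side and Hölder
continuous solution. -/
lemma integral_weak_eq_zero_of_punctured {C α : NNReal} (hα : 0 < α) {v F : Plane → ℝ}
    (hv : HolderOnWith C α v (closedBall 0 1)) (hF : IntegrableOn F (ball 0 1))
    (h : ∀ ζ : Plane → ℝ, ContDiff ℝ ∞ ζ → HasCompactSupport ζ → tsupport ζ ⊆ ball 0 1 \ {0} →
      ∫ x in ball 0 1, (-(v x * Laplacian.laplacian ζ x) + F x * ζ x) = 0)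
    {ζ : Plane → ℝ} (hζ : ContDiff ℝ ∞ ζ) (hK : HasCompactSupport ζ) (hsub : tsupport ζ ⊆ ball 0 1) :
    ∫ x in ball 0 1, (-(v x * Laplacian.laplacian ζ x) + F x * ζ x) = 0 := by
  let η : ContDiffBump (0 : Plane) := ⟨1, 2, by norm_num, by norm_num⟩
  have hηs : ∀ R : ℝ, ContDiff ℝ ∞ fun x : Plane => η (R • x) := fun R =>
    η.contDiff.comp (contDiff_const_smul R)
  have hη0 : ∀ R : ℝ, 0 < R → ∀ x : Plane, 2 / R ≤ ‖x‖ → η (R • x) = 0 := by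
    intro R hR x hx
    refine η.zero_of_le_dist ?_
    rw [dist_zero_right, norm_smul, Real.norm_of_nonneg hR.le]
    rw [div_le_iff₀' hR] at hx
    exact hx
  have hvc : ContinuousOn v (ball 0 1) := (hv.continuousOn hα).mono ball_subset_closedBall
  have hint : ∀ φ : Plane → ℝ, ContDiff ℝ ∞ φ → HasCompactSupport φ → tsupport φ ⊆ ball 0 1 →
      IntegrableOn (fun x => v x * Laplacian.laplacian φ x) (ball 0 1) := fun φ hφ hφK hφs =>
    (integrable_mul_of_continuousOn hvc (continuous_laplacian hφ)
      (hφK.mono' (subset_closure.trans (tsupport_laplacian_subset φ)))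
      ((tsupport_laplacian_subset φ).trans hφs)).integrableOn
  have hFint : ∀ φ : Plane → ℝ, Continuous φ → HasCompactSupport φ →
      IntegrableOn (fun x => F x * φ x) (ball 0 1) := by
    intro φ hφ hφK
    obtain ⟨B, hB⟩ := hφ.bounded_above_of_compact_support hφK
    exact Integrable.mul_bdd hF hφ.aestronglyMeasurable (Filter.Eventually.of_forall hB)
  set φ : ℕ → Plane → ℝ := fun n x => ζ x * η (((n : ℝ) + 1) • x)
  have hφs : ∀ n, ContDiff ℝ ∞ (φ n) := fun n => hζ.mul (hηs _)
  have hφt : ∀ n, tsupport (φ n) ⊆ tsupport ζ := fun n => tsupport_mul_subset_left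
  have hφK : ∀ n, HasCompactSupport (φ n) := fun n => hK.mono' (subset_closure.trans (hφt n))
  -- `ζ - φ n` vanishes near `0`, hence is admissible in `h`; only the part `φ n` near the origin
  -- remains. Subtracting `v 0` is free since `Δ(φ n)` has integral zero.
  have hstep : ∀ n, ∫ x in ball 0 1, (-(v x * Laplacian.laplacian ζ x) + F x * ζ x) =
      -(∫ x in ball 0 1, (v x - v 0) * Laplacian.laplacian (φ n) x)
        + ∫ x in ball 0 1, F x * φ n x := by
    intro n
    have hψ : ContDiff ℝ ∞ (fun x => ζ x - φ n x) := hζ.sub (hφs n)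
    have hψt : tsupport (fun x => ζ x - φ n x) ⊆ tsupport ζ :=
      (tsupport_sub ζ (φ n)).trans (union_subset subset_rfl (hφt n))
    have hψ0 : (0 : Plane) ∉ tsupport (fun x => ζ x - φ n x) := by
      rw [notMem_tsupport_iff_eventuallyEq]
      have h1 : Filter.Tendsto (fun x : Plane => ((n : ℝ) + 1) • x) (nhds 0) (nhds 0) := by
        have : Continuous (fun x : Plane => ((n : ℝ) + 1) • x) := by fun_prop
        simpa using this.tendsto 0
      filter_upwards [h1.eventually η.eventuallyEq_one] with y hy
      simp [φ, hy]
    have h1 := h _ hψ (hK.mono' (subset_closure.trans hψt))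
      (fun x hx => ⟨hsub (hψt hx), fun hx0 => hψ0 (hx0 ▸ hx)⟩)
    have h2 : ∀ x, Laplacian.laplacian (fun x => ζ x - φ n x) x =
        Laplacian.laplacian ζ x - Laplacian.laplacian (φ n) x := fun x =>
      ContDiffAt.laplacian_sub (hζ.of_le (by norm_cast)).contDiffAt
        ((hφs n).of_le (by norm_cast)).contDiffAt
    have i1 := hint ζ hζ hK hsub
    have i2 := hint (φ n) (hφs n) (hφK n) ((hφt n).trans hsub)
    have i3 := hFint ζ hζ.continuous hK
    have i4 := hFint (φ n) (hφs n).continuous (hφK n)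
    have i5 : IntegrableOn (fun x => v 0 * Laplacian.laplacian (φ n) x) (ball 0 1) :=
      (((continuous_laplacian (hφs n)).integrable_of_hasCompactSupport ((hφK n).mono'
        (subset_closure.trans (tsupport_laplacian_subset _)))).const_mul _).integrableOn
    have e1 : ∀ x, -(v x * Laplacian.laplacian (fun x => ζ x - φ n x) x) + F x * (ζ x - φ n x)
        = (-(v x * Laplacian.laplacian ζ x) + F x * ζ x)
          - (-(v x * Laplacian.laplacian (φ n) x) + F x * φ n x) := fun x => by rw [h2]; ring
    have j1 : IntegrableOn (fun x => -(v x * Laplacian.laplacian ζ x) + F x * ζ x) (ball 0 1) :=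
      i1.neg.add i3
    have j2 : IntegrableOn (fun x => -(v x * Laplacian.laplacian (φ n) x) + F x * φ n x)
      (ball 0 1) := i2.neg.add i4
    simp_rw [e1] at h1
    rw [integral_sub j1 j2, sub_eq_zero] at h1
    rw [h1, integral_add (f := fun x => -(v x * Laplacian.laplacian (φ n) x)) i2.neg i4,
      integral_neg]
    congr 2
    simp_rw [sub_mul]
    rw [integral_sub i2 i5, integral_const_mul, setIntegral_eq_integral_of_forall_compl_eq_zero
      (f := Laplacian.laplacian (φ n)), integral_laplacian_eq_zero (hφs n) (hφK n)]
    · simp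
    · intro x hx
      exact image_eq_zero_of_notMem_tsupport fun hx' =>
        hx (hsub (hφt n (tsupport_laplacian_subset _ hx')))
  -- Dominated convergence: `φ n` tends to `0` off the origin and is bounded by `ζ`.
  have hlim2 : Filter.Tendsto (fun n => ∫ x in ball 0 1, F x * φ n x) Filter.atTop (nhds 0) := by
    obtain ⟨B, hB⟩ := hζ.continuous.bounded_above_of_compact_support hK
    have := tendsto_integral_of_dominated_convergence (μ := volume.restrict (ball (0 : Plane) 1))
      (F := fun n x => F x * φ n x) (f := fun _ => 0) (fun x => ‖F x‖ * B)
      (fun n => (hFint (φ n) (hφs n).continuous (hφK n)).aestronglyMeasurable)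
      (hF.norm.mul_const B) (fun n => Filter.Eventually.of_forall fun x => ?_) ?_
    · simpa using this
    · rw [norm_mul, norm_mul, Real.norm_of_nonneg η.nonneg]
      exact mul_le_mul_of_nonneg_left
        ((mul_le_of_le_one_right (norm_nonneg _) η.le_one).trans (hB x)) (norm_nonneg _)
    · refine ae_restrict_of_ae ?_
      have h0 : ∀ᵐ x : Plane, x ≠ 0 := by
        simpa using (measure_eq_zero_iff_ae_notMem.1 (measure_singleton (μ := volume) (0 : Plane)))
      filter_upwards [h0] with x hx
      refine tendsto_const_nhds.congr' ?_
      filter_upwards [Filter.eventually_ge_atTop ⌈2 / ‖x‖⌉₊] with n hn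
      have hx0 : 0 < ‖x‖ := norm_pos_iff.2 hx
      have h3 : 2 / ‖x‖ ≤ n := (Nat.le_ceil _).trans (by exact_mod_cast hn)
      rw [div_le_iff₀ hx0] at h3
      have : η (((n : ℝ) + 1) • x) = 0 := by
        refine hη0 _ (by positivity) x ?_
        rw [div_le_iff₀ (by positivity)]
        nlinarith
      simp [φ, this]
  have hlim1 : Filter.Tendsto
      (fun n => ∫ x in ball 0 1, (v x - v 0) * Laplacian.laplacian (φ n) x)
      Filter.atTop (nhds 0) := by
    obtain ⟨K, hK0, hKb⟩ := exists_bound_laplacian_mul_comp_smul hζ hK η.contDiff η.hasCompactSupport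
    set V := volume.real (ball (0 : Plane) 1)
    -- With `R = n + 1` and `r = 2/R`, the integrand is at most `C r^α · K R²` on a set of area at
    -- most `V r²`; the `4` is `r² R²`.
    have hb : ∀ n : ℕ, ‖∫ x in ball 0 1, (v x - v 0) * Laplacian.laplacian (φ n) x‖ ≤
        (C * K * V * 4) * (2 / ((n : ℝ) + 1)) ^ (α : ℝ) := by
      intro n
      have hR : 0 < (n : ℝ) + 1 := by positivity
      have hsupp : ∀ x ∉ closedBall (0 : Plane) (2 / ((n : ℝ) + 1)),
          Laplacian.laplacian (φ n) x = 0 := by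
        intro x hx
        refine image_eq_zero_of_notMem_tsupport fun hx' => hx ?_
        refine (closure_minimal (fun y hy => ?_) isClosed_closedBall)
          (tsupport_laplacian_subset _ hx')
        rw [mem_closedBall_zero_iff]
        by_contra hy2
        exact hy (by simp only [φ]; rw [hη0 _ hR y (not_le.1 hy2).le, mul_zero])
      have e : ∫ x in ball 0 1, (v x - v 0) * Laplacian.laplacian (φ n) x =
          ∫ x in ball 0 1 ∩ closedBall 0 (2 / ((n : ℝ) + 1)),
            (v x - v 0) * Laplacian.laplacian (φ n) x := by
        refine setIntegral_eq_of_subset_of_forall_sdiff_eq_zero measurableSet_ball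
          inter_subset_left fun x hx => ?_
        rw [hsupp x fun hx' => hx.2 ⟨hx.1, hx'⟩, mul_zero]
      rw [e]
      have hle := norm_setIntegral_le_of_norm_le_const (μ := volume)
        (s := ball (0 : Plane) 1 ∩ closedBall 0 (2 / ((n : ℝ) + 1)))
        (f := fun x => (v x - v 0) * Laplacian.laplacian (φ n) x)
        (C := C * (2 / ((n : ℝ) + 1)) ^ (α : ℝ) * (K * ((n : ℝ) + 1) ^ 2))
        ((measure_mono inter_subset_left).trans_lt measure_ball_lt_top) (fun x hx => ?_)
      · refine hle.trans ?_
        have hvol : volume.real (ball (0 : Plane) 1 ∩ closedBall 0 (2 / ((n : ℝ) + 1))) ≤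
            (2 / ((n : ℝ) + 1)) ^ 2 * V := by
          refine (measureReal_mono inter_subset_right measure_closedBall_lt_top.ne).trans_eq ?_
          rw [measureReal_def, Measure.addHaar_closedBall _ _ (by positivity), ENNReal.toReal_mul,
            ENNReal.toReal_ofReal (by positivity), finrank_euclideanSpace, Fintype.card_fin]
          rfl
        refine (mul_le_mul_of_nonneg_left hvol (by positivity)).trans_eq ?_
        field_simp
        ring
      · rw [norm_mul]
        refine mul_le_mul ?_ (hKb _ (by linarith [Nat.cast_nonneg (α := ℝ) n]) x)
          (norm_nonneg _) (by positivity)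
        have h1 := hv.dist_le (ball_subset_closedBall hx.1) (mem_closedBall_self zero_le_one)
        rw [Real.dist_eq] at h1
        refine h1.trans (mul_le_mul_of_nonneg_left
          (Real.rpow_le_rpow dist_nonneg hx.2 α.2) C.2)
    refine squeeze_zero_norm hb ?_
    have h1 : Filter.Tendsto (fun n : ℕ => 2 / ((n : ℝ) + 1)) Filter.atTop (nhds 0) :=
      tendsto_const_div_atTop_nhds_zero_nat 2 |>.comp (Filter.tendsto_add_atTop_nat 1) |>.congr
        fun n => by simp
    have h2 := (h1.rpow_const (p := (α : ℝ)) (Or.inr α.2)).const_mul (C * K * V * 4)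
    rwa [Real.zero_rpow (by exact_mod_cast hα.ne'), mul_zero] at h2
  have hlim := hlim1.neg.add hlim2
  rw [neg_zero, add_zero] at hlim
  exact tendsto_nhds_unique (tendsto_const_nhds.congr hstep) hlim

/-! ### Closing the cycle of implications -/

/-- If `|∇u|^q` is integrable then `u` extends to a Hölder continuous solution in the disk. -/
lemma exists_holder_extension_of_integrableOn_gradient_rpow {a b m q : ℝ} (hq : 2 < q)
    {u : Plane → ℝ} (hu : ContDiffOn ℝ 1 u (closedBall (0 : Plane) 1 \ {0}))
    (hsol : IsDistributionalSolution a b m q u (ball (0 : Plane) 1 \ {0}))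
    (hint : IntegrableOn (fun x => ‖gradient u x‖ ^ q) (ball 0 1)) :
    ∃ v : Plane → ℝ, EqOn v u (closedBall (0 : Plane) 1 \ {0}) ∧
      IsHolderContinuousOn v (closedBall (0 : Plane) 1) ∧
      IsDistributionalSolution a b m q v (ball (0 : Plane) 1) := by
  obtain ⟨C, α, hα, hα1, hH⟩ := exists_holderOnWith_of_integrableOn_gradient_rpow hq hu hint
  obtain ⟨v, hvu, hv⟩ := HolderOnWith.exists_extension_zero hα hH
  have hU : IsOpen (ball (0 : Plane) 1 \ {0}) := isOpen_ball.sdiff isClosed_singleton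
  have hsub : ball (0 : Plane) 1 \ {0} ⊆ closedBall 0 1 \ {0} :=
    sdiff_subset_sdiff_left ball_subset_closedBall
  have hae : (ball (0 : Plane) 1 \ {0} : Set Plane) =ᵐ[volume] ball (0 : Plane) 1 :=
    sdiff_null_ae_eq_self (measure_singleton _)
  have hgrad : ∀ x ∈ ball (0 : Plane) 1 \ {0}, gradient v x = gradient u x := by
    intro x hx
    have : v =ᶠ[nhds x] u := Filter.mem_of_superset (hU.mem_nhds hx) fun y hy => hvu (hsub hy)
    simp only [gradient, this.fderiv_eq]
  have hvc : ContinuousOn v (closedBall 0 1) := hv.continuousOn hα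
  have hexpc : ContinuousOn (fun x => Real.exp (b * v x)) (closedBall 0 1) := by fun_prop
  have iv : IntegrableOn v (ball 0 1) :=
    (hvc.integrableOn_compact (isCompact_closedBall _ _)).mono_set ball_subset_closedBall
  have iexp : IntegrableOn (fun x => Real.exp (b * v x)) (ball 0 1) :=
    (hexpc.integrableOn_compact (isCompact_closedBall _ _)).mono_set ball_subset_closedBall
  have igrad : IntegrableOn (fun x => ‖gradient v x‖ ^ q) (ball 0 1) := by
    refine IntegrableOn.congr_set_ae (t := ball (0 : Plane) 1 \ {0}) ?_ hae.symm
    exact (hint.mono_set sdiff_subset).congr_fun (fun x hx => by simp only [hgrad x hx])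
      hU.measurableSet
  refine ⟨v, hvu, ⟨C, α, hα, hα1, hv⟩, iv.locallyIntegrableOn, iexp.locallyIntegrableOn,
    igrad.locallyIntegrableOn, fun ζ hζ hK hζs => ?_⟩
  refine integral_weak_eq_zero_of_punctured hα hv
    (F := fun x => a * Real.exp (b * v x) - m * ‖gradient v x‖ ^ q)
    ((iexp.const_mul a).sub (igrad.const_mul m)) (fun φ hφ hφK hφs => ?_) hζ hK hζs
  -- The origin is null and the gradients of `v` and `u` agree off it, so the weak equation for `v`
  -- on punctured test functions is that for `u`.
  rw [← setIntegral_congr_set hae, ← hsol.2.2.2 φ hφ hφK hφs]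
  refine setIntegral_congr_fun hU.measurableSet fun x hx => ?_
  simp only [hgrad x hx, hvu (hsub hx)]

theorem proposition4p2 (a b m q : ℝ) (ha : 0 < a) (hb : 0 < b) (hm : 0 < m) (hq : 2 < q)
    (u : Plane → ℝ)
    (hu : ContDiffOn ℝ 1 u (closedBall (0 : Plane) 1 \ {0}))
    (hpos : ∀ x ∈ ball (0 : Plane) 1 \ {0}, 0 < u x)
    (hsol : IsDistributionalSolution a b m q u (ball (0 : Plane) 1 \ {0})) :
    List.TFAE [
      IntegrableOn (fun x => Real.exp (b * u x)) (ball (0 : Plane) 1) volume,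
      IntegrableOn (fun x => ‖gradient u x‖ ^ q) (ball (0 : Plane) 1) volume,
      ∃ v : Plane → ℝ, EqOn v u (closedBall (0 : Plane) 1 \ {0}) ∧
        IsHolderContinuousOn v (closedBall (0 : Plane) 1) ∧
        IsDistributionalSolution a b m q v (ball (0 : Plane) 1)] := by
  tfae_have 1 → 2 := integrableOn_gradient_rpow_of_integrableOn_exp ha hm hq hu hsol
  tfae_have 2 → 3 := exists_holder_extension_of_integrableOn_gradient_rpow hq hu hsol
  tfae_have 3 → 1 := by
    rintro ⟨v, hvu, ⟨C, α, hα, -, hv⟩, -⟩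
    have hvc : ContinuousOn v (closedBall 0 1) := hv.continuousOn hα
    have hexpc : ContinuousOn (fun x => Real.exp (b * v x)) (closedBall 0 1) := by fun_prop
    have iexp : IntegrableOn (fun x => Real.exp (b * v x)) (ball (0 : Plane) 1 \ {0}) :=
      (hexpc.integrableOn_compact (isCompact_closedBall _ _)).mono_set
        (sdiff_subset.trans ball_subset_closedBall)
    refine IntegrableOn.congr_set_ae (t := ball (0 : Plane) 1 \ {0}) ?_
      (sdiff_null_ae_eq_self (measure_singleton _)).symm
    refine iexp.congr_fun (fun x hx => ?_) (measurableSet_ball.diff (measurableSet_singleton _))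
    simp only [hvu (sdiff_subset_sdiff_left ball_subset_closedBall hx)]
  tfae_finish
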